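/- Let $a<b$, let $n\ge 1$ be an integer, and let $w:[a,b]\to[0,\infty)$ be a weight function, i.e. $w$ is integrable and $\int_a^b w(x)\,dx>0$. A function $f:[a,b]\to\mathbb R$ is called $m$-convex if its divided differences satisfy $[x_1,\dots,x_{m+2};f]\ge 0$ for all distinct $x_1,\dots,x_{m+2}\in[a,b]$, where $[x_1;f]=f(x_1)$ and $[x_1,\dots,x_{k+1};f]=\dfrac{[x_2,\dots,x_{k+1};f]-[x_1,\dots,x_k;f]}{x_{k+1}-x_1}$ for $k\ge 1$. Let $P_n$ (respectively $Q_n$) be the polynomial of degree $n$ obtained from $1,x,x^2,\dots$ by Gram--Schmidt orthogonalization on $[a,b]$ with the weight $(x-a)w(x)$ (respectively $(b-x)w(x)$). Then $P_n$ has $n$ distinct zeros $x_1,\dots,x_n$, all in $(a,b)$, and $Q_n$ has $n$ distinct zeros $y_1,\dots,y_n$, all in $(a,b)$. Define the left and right $(n+1)$-point Radau-type quadratures by $$\mathcal R^l_{n+1}(f)=\left(\frac{1}{P_n(a)^2}\int_a^b P_n(x)^2w(x)\,dx\right)f(a)+\sum_{i=1}^n\left(\frac1{x_i-a}\int_a^b\frac{P_n(x)(x-a)w(x)}{(x-x_i)P_n'(x_i)}\,dx\right)f(x_i),$$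 $$\mathcal R^r_{n+1}(f)=\sum_{i=1}^n\left(\frac1{b-y_i}\int_a^b\frac{Q_n(x)(b-x)w(x)}{(x-y_i)Q_n'(y_i)}\,dx\right)f(y_i)+\left(\frac{1}{Q_n(b)^2}\int_a^b Q_n(x)^2w(x)\,dx\right)f(b).$$ For every $2n$-convex function $f:[a,b]\to\mathbb R$, the product $fw$ is integrable on $[a,b]$ and $$\mathcal R^l_{n+1}(f)\le\int_a^b f(x)w(x)\,dx\le\mathcal R^r_{n+1}(f).$$ Integrals and integrability are understood in the sense of Lebesgue. -/

import Mathlib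

open MeasureTheory Polynomial

/-- Divided difference `[x₀, …, xₙ; f]`, defined by the usual recursion on the number of points. -/
noncomputable def dividedDiff (f : ℝ → ℝ) : (n : ℕ) → (Fin (n + 1) → ℝ) → ℝ
  | 0, x => f (x 0)
  | n + 1, x =>
      (dividedDiff f n (fun i => x i.succ) - dividedDiff f n (fun i => x i.castSucc)) /
        (x (Fin.last (n + 1)) - x 0)

/-- `f` is `n`-convex on `I`: all divided differences on `n + 2` distinct points of `I`
are nonnegative. -/
def IsHigherConvexOn (n : ℕ) (I : Set ℝ) (f : ℝ → ℝ) : Prop :=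
  ∀ x : Fin (n + 2) → ℝ, Function.Injective x → (∀ i, x i ∈ I) → 0 ≤ dividedDiff f (n + 1) x

/-- `w` is a weight function on `[a, b]`: nonnegative, integrable, with positive integral. -/
structure IsWeight (a b : ℝ) (w : ℝ → ℝ) : Prop where
  nonneg : ∀ x ∈ Set.Icc a b, 0 ≤ w x
  integrable : IntervalIntegrable w volume a b
  integral_pos : 0 < ∫ x in a..b, w x

/-- The inner product `⟨p, q⟩_w = ∫ₐᵇ p q w` on polynomials. -/
noncomputable def weightedInner (a b : ℝ) (w : ℝ → ℝ) (p q : ℝ[X]) : ℝ :=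
  ∫ x in a..b, p.eval x * q.eval x * w x

/-- The `n`-th polynomial obtained from the monomials `1, X, X², …` by Gram–Schmidt
orthogonalization with respect to `⟨·, ·⟩_w` on `[a, b]`. -/
noncomputable def orthoPoly (a b : ℝ) (w : ℝ → ℝ) (n : ℕ) : ℝ[X] :=
  X ^ n - ∑ k : Fin n,
    C (weightedInner a b w (X ^ n) (orthoPoly a b w k) /
        weightedInner a b w (orthoPoly a b w k) (orthoPoly a b w k)) * orthoPoly a b w k
termination_by n
decreasing_by all_goals exact k.2

/-- The degree `n` orthogonal polynomial on `[a, b]` for the weight `(x - a) w(x)`. -/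
noncomputable def radauLeftPoly (a b : ℝ) (w : ℝ → ℝ) (n : ℕ) : ℝ[X] :=
  orthoPoly a b (fun x => (x - a) * w x) n

/-- The degree `n` orthogonal polynomial on `[a, b]` for the weight `(b - x) w(x)`. -/
noncomputable def radauRightPoly (a b : ℝ) (w : ℝ → ℝ) (n : ℕ) : ℝ[X] :=
  orthoPoly a b (fun x => (b - x) * w x) n

/-- The left Radau-type quadrature with the `n + 1` abscissas `a` and the zeros of
`radauLeftPoly a b w n`. -/
noncomputable def radauLeft (a b : ℝ) (w : ℝ → ℝ) (n : ℕ) (f : ℝ → ℝ) : ℝ :=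
  (1 / (radauLeftPoly a b w n).eval a ^ 2 *
      ∫ x in a..b, (radauLeftPoly a b w n).eval x ^ 2 * w x) * f a +
    ∑ t ∈ (radauLeftPoly a b w n).roots.toFinset,
      (1 / (t - a) *
        ∫ x in a..b, (radauLeftPoly a b w n).eval x * (x - a) * w x /
          ((x - t) * (derivative (radauLeftPoly a b w n)).eval t)) * f t

/-- The right Radau-type quadrature with the `n + 1` abscissas given by the zeros of
`radauRightPoly a b w n` and `b`. -/
noncomputable def radauRight (a b : ℝ) (w : ℝ → ℝ) (n : ℕ) (f : ℝ → ℝ) : ℝ :=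
  (∑ t ∈ (radauRightPoly a b w n).roots.toFinset,
      (1 / (b - t) *
        ∫ x in a..b, (radauRightPoly a b w n).eval x * (b - x) * w x /
          ((x - t) * (derivative (radauRightPoly a b w n)).eval t)) * f t) +
    (1 / (radauRightPoly a b w n).eval b ^ 2 *
      ∫ x in a..b, (radauRightPoly a b w n).eval x ^ 2 * w x) * f b

/-! Each quadrature integrates polynomials of degree at most `2 * n` exactly and samples a function
only at its nodes. So it suffices to find such polynomials `L ≤ f ≤ U` on `[a, b]`, with `L`
agreeing with `f` at the left nodes and `U` at the right ones: the quadrature of `f` then equals the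
integral of `L w` or of `U w`.

These bounds come from `IsHigherConvexOn.exists_interpolant`. Interpolate `f` at the endpoint `c`,
at the interior nodes `t`, and at their shifts `t + ε`. The error at `x` is a nonnegative divided
difference times `(x - c) ∏ (x - t) (x - t - ε)`, and as `ε → 0` the double product becomes a
square, leaving the sign of `x - c`. No derivative of `f` is used: divided differences on `2 * n +
1` points are monotone in each point, which bounds the interpolants, and compactness gives a limit
polynomial.

Exactness (`radau_exact`) is Gauss quadrature for the modified weight: subtracting a multiple of `P
^ 2`, which vanishes at the interior nodes, makes the polynomial divisible by `x - c`, and division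
by `P` with orthogonality finishes. -/

/-! ### Divided differences on finite sets -/

/-- The divided difference of `f` on a finite set of points, in its explicit symmetric form. -/
noncomputable def finsetDividedDiff (f : ℝ → ℝ) (s : Finset ℝ) : ℝ :=
  ∑ i ∈ s, Lagrange.nodalWeight s id i * f i

theorem nodalWeight_erase_eq {s : Finset ℝ} {i v : ℝ} (hv : v ∈ s) (hiv : i ≠ v) :
    Lagrange.nodalWeight (s.erase v) id i = Lagrange.nodalWeight s id i * (i - v) := by
  unfold Lagrange.nodalWeight
  have h : v ∈ s.erase i := Finset.mem_erase.2 ⟨hiv.symm, hv⟩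
  rw [← Finset.mul_prod_erase _ _ h, Finset.erase_right_comm]
  have : i - v ≠ 0 := sub_ne_zero.2 hiv
  simp only [id]
  field_simp

theorem finsetDividedDiff_erase (f : ℝ → ℝ) {s : Finset ℝ} {v : ℝ} (hv : v ∈ s) :
    finsetDividedDiff f (s.erase v) = ∑ i ∈ s, Lagrange.nodalWeight s id i * (i - v) * f i := by
  rw [← Finset.add_sum_erase _ _ hv, finsetDividedDiff]
  simp only [sub_self, mul_zero, zero_mul, zero_add]
  refine Finset.sum_congr rfl fun i hi => ?_
  rw [nodalWeight_erase_eq hv (Finset.ne_of_mem_erase hi)]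

/-- The defining recursion with an arbitrary pair of points removed, since symmetry makes the first
and last points irrelevant. Termwise it is `(i - v) - (i - u) = u - v`. -/
theorem finsetDividedDiff_erase_sub_erase (f : ℝ → ℝ) {s : Finset ℝ} {u v : ℝ}
    (hu : u ∈ s) (hv : v ∈ s) :
    finsetDividedDiff f (s.erase v) - finsetDividedDiff f (s.erase u) =
      (u - v) * finsetDividedDiff f s := by
  rw [finsetDividedDiff_erase f hu, finsetDividedDiff_erase f hv, finsetDividedDiff,
    ← Finset.sum_sub_distrib, Finset.mul_sum]
  exact Finset.sum_congr rfl fun i _ => by ring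

theorem dividedDiff_eq_finsetDividedDiff (f : ℝ → ℝ) :
    ∀ (n : ℕ) (x : Fin (n + 1) → ℝ), Function.Injective x →
      dividedDiff f n x = finsetDividedDiff f (Finset.univ.image x)
  | 0, x, _ => by
      simp [dividedDiff, finsetDividedDiff, Lagrange.nodalWeight]
  | n + 1, x, hx => by
      have h1 : Finset.univ.image (fun i : Fin (n + 1) => x i.succ) =
          (Finset.univ.image x).erase (x 0) := by
        ext t
        simp only [Finset.mem_image, Finset.mem_univ, true_and, Finset.mem_erase]
        constructor
        · rintro ⟨i, rfl⟩
          exact ⟨fun h => Fin.succ_ne_zero i (hx h), _, rfl⟩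
        · rintro ⟨h, i, rfl⟩
          obtain ⟨j, rfl⟩ := Fin.exists_succ_eq.2 (fun h' : i = 0 => h (by rw [h']))
          exact ⟨j, rfl⟩
      have h2 : Finset.univ.image (fun i : Fin (n + 1) => x i.castSucc) =
          (Finset.univ.image x).erase (x (Fin.last (n + 1))) := by
        ext t
        simp only [Finset.mem_image, Finset.mem_univ, true_and, Finset.mem_erase]
        constructor
        · rintro ⟨i, rfl⟩
          exact ⟨fun h => (Fin.castSucc_lt_last i).ne (hx h), _, rfl⟩
        · rintro ⟨h, i, rfl⟩
          obtain ⟨j, rfl⟩ := Fin.exists_castSucc_eq.2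
            (fun h' : i = Fin.last (n + 1) => h (by rw [h']))
          exact ⟨j, rfl⟩
      have hne : x (Fin.last (n + 1)) - x 0 ≠ 0 :=
        sub_ne_zero.2 fun h => (Fin.last_pos (n := n)).ne' (hx h)
      rw [dividedDiff, dividedDiff_eq_finsetDividedDiff f n (fun i => x i.succ)
          (hx.comp (Fin.succ_injective _)),
        dividedDiff_eq_finsetDividedDiff f n (fun i => x i.castSucc)
          (hx.comp (Fin.castSucc_injective _)), h1, h2,
        finsetDividedDiff_erase_sub_erase f
          (Finset.mem_image_of_mem x (Finset.mem_univ (Fin.last (n + 1))))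
          (Finset.mem_image_of_mem x (Finset.mem_univ 0))]
      field_simp

/-! ### Monotonicity of divided differences in their nodes -/

theorem IsHigherConvexOn.finsetDividedDiff_nonneg {m : ℕ} {I : Set ℝ} {f : ℝ → ℝ}
    (hf : IsHigherConvexOn m I f) {s : Finset ℝ} (hs : s.card = m + 2) (hI : ∀ t ∈ s, t ∈ I) :
    0 ≤ finsetDividedDiff f s := by
  have h := hf (s.orderEmbOfFin hs) (s.orderEmbOfFin hs).injective
    fun i => hI _ (s.orderEmbOfFin_mem hs i)
  rwa [dividedDiff_eq_finsetDividedDiff f _ _ (s.orderEmbOfFin hs).injective,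
    Finset.image_orderEmbOfFin_univ] at h

theorem IsHigherConvexOn.finsetDividedDiff_insert_le {m : ℕ} {I : Set ℝ} {f : ℝ → ℝ}
    (hf : IsHigherConvexOn m I f) {s : Finset ℝ} (hs : s.card = m) (hI : ∀ t ∈ s, t ∈ I)
    {u v : ℝ} (hu : u ∈ I) (hv : v ∈ I) (hus : u ∉ s) (hvs : v ∉ s) (huv : u < v) :
    finsetDividedDiff f (insert u s) ≤ finsetDividedDiff f (insert v s) := by
  have hu' : u ∉ insert v s := by simp [hus, huv.ne]
  have hv' : v ∉ insert u s := by simp [hvs, huv.ne']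
  have h := finsetDividedDiff_erase_sub_erase f (s := insert u (insert v s)) (u := v) (v := u)
    (by simp) (by simp)
  rw [Finset.erase_insert hu', Finset.insert_comm, Finset.erase_insert hv'] at h
  have h0 : 0 ≤ finsetDividedDiff f (insert v (insert u s)) := by
    refine hf.finsetDividedDiff_nonneg ?_ ?_
    · rw [Finset.card_insert_of_notMem hv', Finset.card_insert_of_notMem hus, hs]
    · simp only [Finset.mem_insert]
      rintro t (rfl | rfl | ht)
      exacts [hv, hu, hI t ht]
  nlinarith [mul_nonneg (sub_nonneg.2 huv.le) h0]

/-- The nodes move one at a time. The conditions `u i ≠ v j` keep every intermediate configuration,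
part moved and part not, free of collisions. -/
theorem IsHigherConvexOn.finsetDividedDiff_union_image_le {m : ℕ} {I : Set ℝ} {f : ℝ → ℝ}
    (hf : IsHigherConvexOn m I f) {u v : ℝ → ℝ} (s : Finset ℝ) :
    ∀ F : Finset ℝ, F.card + s.card = m + 1 → (∀ t ∈ F, t ∈ I) →
      (∀ i ∈ s, u i ∈ I ∧ v i ∈ I ∧ u i < v i ∧ u i ∉ F ∧ v i ∉ F) →
      (∀ i ∈ s, ∀ j ∈ s, i ≠ j → u i ≠ u j ∧ u i ≠ v j ∧ v i ≠ v j) →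
      finsetDividedDiff f (F ∪ s.image u) ≤ finsetDividedDiff f (F ∪ s.image v) := by
  induction s using Finset.induction_on with
  | empty => simp
  | insert i s hi ih =>
    intro F hc hF hs hd
    obtain ⟨hu, hv, huv, huF, hvF⟩ := hs i (by simp)
    have hne : ∀ j ∈ s, i ≠ j := fun j hj h => hi (h ▸ hj)
    have hd' : ∀ j ∈ s, u i ≠ u j ∧ u i ≠ v j ∧ v i ≠ v j := fun j hj =>
      hd i (by simp) j (by simp [hj]) (hne j hj)
    rw [Finset.card_insert_of_notMem hi] at hc
    have key := ih (insert (u i) F) (by rw [Finset.card_insert_of_notMem huF]; omega)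
      (by simp only [Finset.mem_insert]; rintro t (rfl | ht); exacts [hu, hF t ht])
      (fun j hj => by
        obtain ⟨h1, h2, h3, h4, h5⟩ := hs j (by simp [hj])
        refine ⟨h1, h2, h3, ?_, ?_⟩
        · simp [h4, (hd' j hj).1.symm]
        · simp [h5, (hd' j hj).2.1.symm])
      (fun j hj k hk => hd j (by simp [hj]) k (by simp [hk]))
    have hcard : (F ∪ s.image v).card = m := by
      rw [Finset.card_union_of_disjoint, Finset.card_image_of_injOn]
      · omega
      · intro j hj k hk hjk
        by_contra hne'
        exact (hd j (by simp_all) k (by simp_all) hne').2.2 hjk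
      · rw [Finset.disjoint_right]
        intro t ht
        obtain ⟨j, hj, rfl⟩ := Finset.mem_image.1 ht
        exact (hs j (by simp [hj])).2.2.2.2
    have key2 := hf.finsetDividedDiff_insert_le hcard
      (by
        simp only [Finset.mem_union, Finset.mem_image]
        rintro t (ht | ⟨j, hj, rfl⟩)
        exacts [hF t ht, (hs j (by simp [hj])).2.1])
      hu hv
      (by
        simp only [Finset.mem_union, Finset.mem_image, not_or, not_exists, not_and]
        exact ⟨huF, fun j hj h => (hd' j hj).2.1 h.symm⟩)
      (by
        simp only [Finset.mem_union, Finset.mem_image, not_or, not_exists, not_and]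
        exact ⟨hvF, fun j hj h => (hd' j hj).2.2 h.symm⟩)
      huv
    rw [Finset.insert_union] at key
    rw [Finset.image_insert, Finset.image_insert, Finset.union_insert, Finset.union_insert]
    refine le_trans ?_ key2
    rwa [Finset.insert_union] at key

/-! ### Interpolation with nodes doubled in the limit -/

theorem sub_eval_interpolate_eq (f : ℝ → ℝ) {s : Finset ℝ} {z : ℝ} (hz : z ∉ s) :
    f z - (Lagrange.interpolate s id f).eval z =
      finsetDividedDiff f (insert z s) * ∏ t ∈ s, (z - t) := by
  have hz' : ∀ i ∈ s, z ≠ id i := fun i hi h => hz (h ▸ hi)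
  have hp : ∏ t ∈ s, (z - t) ≠ 0 := Finset.prod_ne_zero_iff.2 fun t ht => sub_ne_zero.2 (hz' t ht)
  rw [Lagrange.eval_interpolate_not_at_node _ hz', finsetDividedDiff, Finset.sum_insert hz,
    Lagrange.eval_nodal, Lagrange.nodalWeight, Finset.erase_insert hz, Finset.prod_inv_distrib,
    add_mul]
  simp only [id]
  have h : ∑ i ∈ s, Lagrange.nodalWeight (insert z s) id i * f i =
      - ∑ i ∈ s, Lagrange.nodalWeight s id i * (z - i)⁻¹ * f i := by
    rw [← Finset.sum_neg_distrib]
    refine Finset.sum_congr rfl fun i hi => ?_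
    have hiz : i ≠ z := fun h => hz (h ▸ hi)
    have := nodalWeight_erase_eq (s := insert z s) (v := z) (i := i) (by simp) hiz
    rw [Finset.erase_insert hz] at this
    rw [this]
    have h1 : i - z ≠ 0 := sub_ne_zero.2 hiz
    have h2 : z - i ≠ 0 := sub_ne_zero.2 hiz.symm
    field_simp
    ring
  rw [h]
  field_simp
  ring

/-- The factor 2 leaves room for two nodes displaced by up to `η` in opposite directions. -/
theorem exists_pos_separation (F : Finset ℝ) :
    ∃ η > 0, ∀ p ∈ F, ∀ q ∈ F, p ≠ q → 2 * η < |p - q| := by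
  have h : ∀ᶠ η in nhdsWithin (0 : ℝ) (Set.Ioi 0), ∀ p ∈ F, ∀ q ∈ F, p ≠ q → 2 * η < |p - q| := by
    simp only [Filter.eventually_all_finset, Filter.eventually_imp_distrib_left]
    intro p _ q _ hpq
    refine Filter.Tendsto.eventually_lt_const (v := 2 * 0) (by simpa [sub_eq_zero] using hpq) ?_
    exact (Filter.tendsto_id.mono_left nhdsWithin_le_nhds).const_mul 2
  obtain ⟨η, hη, h0⟩ := (h.and self_mem_nhdsWithin).exists
  exact ⟨η, h0, hη⟩

/-- A bounded sequence of values on finitely many nodes yields a convergent subsequence of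
polynomials. -/
theorem exists_polynomial_subseq_tendsto (Z : Finset ℝ) (H : ℕ → ℝ[X])
    (hdeg : ∀ k, (H k).degree < Z.card) (M : ℝ → ℝ) (hM : ∀ k, ∀ z ∈ Z, |(H k).eval z| ≤ M z) :
    ∃ (G : ℝ[X]) (φ : ℕ → ℕ), G.degree < Z.card ∧ StrictMono φ ∧
      ∀ x, Filter.Tendsto (fun k => (H (φ k)).eval x) Filter.atTop (nhds (G.eval x)) := by
  have hinj : Set.InjOn (Subtype.val : Z → ℝ) (Finset.univ : Finset Z) :=
    Subtype.val_injective.injOn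
  have hcard : (Finset.univ : Finset Z).card = Z.card := by simp
  -- The degree bound makes each polynomial determined by its values on `Z`, so compactness of a box
  -- of values suffices.
  obtain ⟨r, -, φ, hφ, hr⟩ := (isCompact_Icc (a := fun z : Z => -M z) (b := fun z : Z => M z)).tendsto_subseq
    (x := fun k (z : Z) => (H k).eval (z : ℝ))
    fun k => ⟨fun z => (abs_le.1 (hM k z z.2)).1, fun z => (abs_le.1 (hM k z z.2)).2⟩
  refine ⟨Lagrange.interpolate Finset.univ (Subtype.val : Z → ℝ) r, φ, ?_, hφ, fun x => ?_⟩
  · rw [← hcard]; exact Lagrange.degree_interpolate_lt _ hinj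
  · have hH : ∀ k, H k = Lagrange.interpolate Finset.univ (Subtype.val : Z → ℝ)
        (fun z => (H k).eval (z : ℝ)) := fun k =>
      Lagrange.eq_interpolate hinj (by rw [hcard]; exact hdeg k)
    have he : ∀ s : Z → ℝ, (Lagrange.interpolate Finset.univ (Subtype.val : Z → ℝ) s).eval x =
        ∑ z, s z * (Lagrange.basis Finset.univ (Subtype.val : Z → ℝ) z).eval x := fun s => by
      simp [Lagrange.interpolate_apply, Polynomial.eval_finsetSum]
    rw [he]
    have : (fun k => (H (φ k)).eval x) = fun k =>
        ∑ z : Z, (H (φ k)).eval (z : ℝ) * (Lagrange.basis Finset.univ (Subtype.val : Z → ℝ) z).eval x := by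
      ext k
      conv_lhs => rw [hH (φ k), he]
    rw [this]
    exact tendsto_finsetSum _ fun z _ => ((tendsto_pi_nhds.1 hr) z).mul_const _

theorem add_notMem_of_separated {η ε : ℝ} {N W : Finset ℝ} (hNW : N ⊆ W)
    (hsep : ∀ p ∈ W, ∀ q ∈ W, p ≠ q → 2 * η < |p - q|) (hε0 : ε ≠ 0) (hε : |ε| ≤ η) :
    ∀ x ∈ N, x + ε ∉ W := by
  intro x hx hmem
  have := hsep _ hmem _ (hNW hx) (by simpa using hε0)
  rw [add_sub_cancel_left] at this
  have := abs_nonneg ε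
  linarith

theorem card_union_image_add {η ε : ℝ} {F N W : Finset ℝ} (hNW : N ⊆ W) (hFW : F ⊆ W)
    (hsep : ∀ p ∈ W, ∀ q ∈ W, p ≠ q → 2 * η < |p - q|) (hε0 : ε ≠ 0) (hε : |ε| ≤ η) :
    (F ∪ N.image (· + ε)).card = F.card + N.card := by
  rw [Finset.card_union_of_disjoint, Finset.card_image_of_injective _ (add_left_injective ε)]
  rw [Finset.disjoint_right]
  intro t ht
  obtain ⟨j, hj, rfl⟩ := Finset.mem_image.1 ht
  exact fun h => add_notMem_of_separated hNW hsep hε0 hε j hj (hFW h)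

theorem IsHigherConvexOn.finsetDividedDiff_union_image_add_mono {m : ℕ} {a b : ℝ} {f : ℝ → ℝ}
    (hf : IsHigherConvexOn m (Set.Icc a b) f) {F N W : Finset ℝ} (hNW : N ⊆ W) (hFW : F ⊆ W)
    (hN : ∀ t ∈ N, t ∈ Set.Ioo a b) (hF : ∀ t ∈ F, t ∈ Set.Icc a b) (ha : a ∈ W) (hb : b ∈ W)
    {η : ℝ} (hsep : ∀ p ∈ W, ∀ q ∈ W, p ≠ q → 2 * η < |p - q|)
    (hcard : F.card + N.card = m + 1) {ε δ : ℝ} (hε0 : ε ≠ 0) (hδ0 : δ ≠ 0) (hε : |ε| ≤ η)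
    (hδ : |δ| ≤ η) (hεδ : ε < δ) :
    finsetDividedDiff f (F ∪ N.image (· + ε)) ≤ finsetDividedDiff f (F ∪ N.image (· + δ)) := by
  have hI : ∀ i ∈ N, ∀ ε, |ε| ≤ η → i + ε ∈ Set.Icc a b := by
    intro i hi ε hε
    have h1 := hsep i (hNW hi) a ha (hN i hi).1.ne'
    have h2 := hsep b hb i (hNW hi) (hN i hi).2.ne'
    rw [abs_of_pos (sub_pos.2 (hN i hi).1)] at h1
    rw [abs_of_pos (sub_pos.2 (hN i hi).2)] at h2
    have := abs_le.1 hε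
    exact ⟨by linarith, by linarith⟩
  refine hf.finsetDividedDiff_union_image_le N F hcard hF (fun i hi => ?_) fun i hi j hj hij => ?_
  · exact ⟨hI i hi ε hε, hI i hi δ hδ, by simpa using hεδ,
      fun h => add_notMem_of_separated hNW hsep hε0 hε i hi (hFW h),
      fun h => add_notMem_of_separated hNW hsep hδ0 hδ i hi (hFW h)⟩
  · refine ⟨by simpa using hij, fun h => ?_, by simpa using hij⟩
    have h1 := hsep i (hNW hi) j (hNW hj) hij
    have h2 : i - j = δ - ε := by linarith
    rw [h2] at h1
    have := abs_sub δ ε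
    linarith

theorem IsHigherConvexOn.exists_interpolant {a b : ℝ} (hab : a < b) {n : ℕ} {f : ℝ → ℝ}
    (hf : IsHigherConvexOn (2 * n) (Set.Icc a b) f) {c : ℝ} (hc : c ∈ Set.Icc a b) {N : Finset ℝ}
    (hN : ∀ t ∈ N, t ∈ Set.Ioo a b) (hcN : c ∉ N) (hNc : N.card = n) :
    ∃ H : ℝ[X], H.degree < (2 * n + 1 : ℕ) ∧ H.eval c = f c ∧ (∀ t ∈ N, H.eval t = f t) ∧
      ∀ x ∈ Set.Icc a b, 0 ≤ (x - c) * (f x - H.eval x) := by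
  -- `Z` holds test points off the nodes; `2 * n + 1` values control a polynomial of degree at most
  -- `2 * n`.
  obtain ⟨Z, hZsub, hZc⟩ := ((Set.Ioo_infinite hab).sdiff
    (insert c N).finite_toSet).exists_subset_card_eq (2 * n + 1)
  have hZ : ∀ z ∈ Z, z ∈ Set.Ioo a b ∧ z ≠ c ∧ z ∉ N := fun z hz => by
    have := hZsub hz
    simpa [not_or] using this
  set W : Finset ℝ := insert a (insert b (insert c (N ∪ Z))) with hW
  obtain ⟨η, hη, hsep⟩ := exists_pos_separation W
  have hNW : N ⊆ W := fun t ht => by simp [hW, ht]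
  have hZW : ∀ z ∈ Z, z ∈ W := fun t ht => by simp [hW, ht]
  have haW : a ∈ W := by simp [hW]
  have hbW : b ∈ W := by simp [hW]
  have hcW : c ∈ W := by simp [hW]
  have hcNW : insert c N ⊆ W := Finset.insert_subset hcW hNW
  let e : ℕ → ℝ := fun k => η / (k + 2)
  have he0 : ∀ k, 0 < e k := fun k => by positivity
  have heη : ∀ k, e k < η := fun k => by
    rw [div_lt_iff₀ (by positivity)]
    have : (0 : ℝ) ≤ k := k.cast_nonneg
    nlinarith
  have heabs : ∀ k, |e k| ≤ η := fun k => by rw [abs_of_pos (he0 k)]; exact (heη k).le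
  have hηabs : |η| ≤ η := (abs_of_pos hη).le
  have hηabs' : |-η| ≤ η := by rw [abs_neg]; exact hηabs
  have hetend : Filter.Tendsto e Filter.atTop (nhds 0) :=
    Filter.Tendsto.div_atTop tendsto_const_nhds
      (Filter.tendsto_atTop_add_const_right _ _ tendsto_natCast_atTop_atTop)
  let Y : ℕ → Finset ℝ := fun k => insert c N ∪ N.image (· + e k)
  have hYc : ∀ k, (Y k).card = 2 * n + 1 := fun k => by
    rw [card_union_image_add hNW hcNW hsep (he0 k).ne' (heabs k),
      Finset.card_insert_of_notMem hcN, hNc]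
    ring
  have hprod : ∀ k x, ∏ t ∈ Y k, (x - t) = (x - c) * ∏ t ∈ N, ((x - t) * (x - (t + e k))) := by
    intro k x
    rw [Finset.prod_union, Finset.prod_insert hcN, Finset.prod_image
      (add_left_injective (e k)).injOn, Finset.prod_mul_distrib, mul_assoc]
    rw [Finset.disjoint_right]
    intro t ht
    obtain ⟨j, hj, rfl⟩ := Finset.mem_image.1 ht
    exact fun h => add_notMem_of_separated hNW hsep (he0 k).ne' (heabs k) j hj (hcNW h)
  let H : ℕ → ℝ[X] := fun k => Lagrange.interpolate (Y k) id f
  have hHdeg : ∀ k, (H k).degree < Z.card := fun k => by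
    rw [hZc, ← hYc k]
    exact Lagrange.degree_interpolate_lt _ Function.injective_id.injOn
  have hHnode : ∀ k, ∀ t ∈ insert c N, (H k).eval t = f t := fun k t ht =>
    Lagrange.eval_interpolate_at_node f (v := id) Function.injective_id.injOn
      (Finset.mem_union_left _ ht)
  -- the divided differences of order `2 * n` are bounded uniformly in `k`
  have hbound : ∀ F : Finset ℝ, F ⊆ W → (∀ t ∈ F, t ∈ Set.Icc a b) → F.card = n + 1 →
      ∃ B, ∀ k, |finsetDividedDiff f (F ∪ N.image (· + e k))| ≤ B := by
    intro F hFW hF hFc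
    -- By monotonicity the shifts `-η` and `η` bracket every shift `e k`. A zero shift cannot serve
    -- as lower bound, because `F` may meet `N`.
    refine ⟨max |finsetDividedDiff f (F ∪ N.image (· + -η))|
      |finsetDividedDiff f (F ∪ N.image (· + η))|, fun k => abs_le_max_abs_abs ?_ ?_⟩
    · exact hf.finsetDividedDiff_union_image_add_mono hNW hFW hN hF haW hbW hsep (by omega)
        (neg_ne_zero.2 hη.ne') (he0 k).ne' hηabs' (heabs k) (by linarith [he0 k])
    · exact hf.finsetDividedDiff_union_image_add_mono hNW hFW hN hF haW hbW hsep (by omega)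
        (he0 k).ne' hη.ne' (heabs k) hηabs (heη k)
  have hMex : ∀ z, ∃ M, ∀ k, z ∈ Z → |(H k).eval z| ≤ M := by
    intro z
    by_cases hz : z ∈ Z
    swap
    · exact ⟨0, fun k h => absurd h hz⟩
    obtain ⟨hzI, hzc, hzN⟩ := hZ z hz
    obtain ⟨B₁, hB₁⟩ := hbound (insert z N) (Finset.insert_subset (hZW z hz) hNW)
      (by
        simp only [Finset.mem_insert]
        rintro t (rfl | ht)
        exacts [Set.Ioo_subset_Icc_self hzI, Set.Ioo_subset_Icc_self (hN t ht)])
      (by rw [Finset.card_insert_of_notMem hzN, hNc])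
    obtain ⟨B₂, hB₂⟩ := hbound (insert c N) hcNW
      (by
        simp only [Finset.mem_insert]
        rintro t (rfl | ht)
        exacts [hc, Set.Ioo_subset_Icc_self (hN t ht)])
      (by rw [Finset.card_insert_of_notMem hcN, hNc])
    let K : ℝ := ∏ t ∈ N, ((b - a) * (2 * (b - a)))
    refine ⟨|f z| + (B₁ + B₂) * K, fun k _ => ?_⟩
    have hek := add_notMem_of_separated hNW hsep (he0 k).ne' (heabs k)
    have hzY : z ∉ Y k := by
      simp only [Y, Finset.mem_union, Finset.mem_insert, Finset.mem_image, not_or, not_exists,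
        not_and]
      exact ⟨⟨hzc, hzN⟩, fun t ht h => hek t ht (h ▸ hZW z hz)⟩
    have herr := sub_eval_interpolate_eq f hzY
    have h1 : (insert z (Y k)).erase z = insert c N ∪ N.image (· + e k) :=
      Finset.erase_insert hzY
    have h2 : (insert z (Y k)).erase c = insert z N ∪ N.image (· + e k) := by
      have hcY : c ∉ insert z N ∪ N.image (· + e k) := by
        simp only [Finset.mem_union, Finset.mem_insert, Finset.mem_image, not_or, not_exists,
          not_and]
        exact ⟨⟨hzc.symm, hcN⟩, fun t ht h => hek t ht (h ▸ hcW)⟩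
      rw [show insert z (Y k) = insert c (insert z N ∪ N.image (· + e k)) by
        simp only [Y, Finset.insert_union]; rw [Finset.insert_comm], Finset.erase_insert hcY]
    -- The factor `z - c` of the error turns the difference on `2 * n + 2` points, which has no a
    -- priori upper bound, into a difference of two bounded ones on `2 * n + 1` points.
    have hrec := finsetDividedDiff_erase_sub_erase f (s := insert z (Y k)) (u := z) (v := c)
      (by simp) (by simp [Y])
    rw [h1, h2] at hrec
    rw [hprod, ← mul_assoc, mul_comm _ (z - c), ← hrec] at herr
    have hK : |∏ t ∈ N, ((z - t) * (z - (t + e k)))| ≤ K := by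
      rw [Finset.abs_prod]
      refine Finset.prod_le_prod (fun _ _ => abs_nonneg _) fun t ht => ?_
      rw [abs_mul]
      have htI := hN t ht
      have hlt : e k < b - a := by
        have := hsep b hbW a haW hab.ne'
        rw [abs_of_pos (sub_pos.2 hab)] at this
        linarith [heη k]
      refine mul_le_mul ?_ ?_ (abs_nonneg _) (by linarith)
      · rw [abs_le]; constructor <;> linarith [hzI.1, hzI.2, htI.1, htI.2]
      · rw [abs_le]; constructor <;> linarith [hzI.1, hzI.2, htI.1, htI.2, he0 k]
    have hD : |finsetDividedDiff f (insert z N ∪ N.image (· + e k)) -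
        finsetDividedDiff f (insert c N ∪ N.image (· + e k))| ≤ B₁ + B₂ :=
      (abs_sub _ _).trans (add_le_add (hB₁ k) (hB₂ k))
    have hfin : |f z - (H k).eval z| ≤ (B₁ + B₂) * K := by
      rw [herr, abs_mul]
      exact mul_le_mul hD hK (abs_nonneg _) ((abs_nonneg _).trans hD)
    have := abs_sub (f z) (f z - (H k).eval z)
    rw [sub_sub_cancel] at this
    linarith
  choose M hM using hMex
  obtain ⟨G, φ, hGdeg, hφ, hG⟩ := exists_polynomial_subseq_tendsto Z H hHdeg M
    fun k z hz => hM z k hz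
  have hGnode : ∀ t ∈ insert c N, G.eval t = f t := fun t ht =>
    tendsto_nhds_unique (hG t) (by simp only [hHnode _ t ht]; exact tendsto_const_nhds)
  refine ⟨G, by rwa [hZc] at hGdeg, hGnode c (by simp), fun t ht => hGnode t (by simp [ht]),
    fun x hx => ?_⟩
  by_cases hxS : x ∈ insert c N
  · rw [hGnode x hxS]; simp
  have hxc : x ≠ c := fun h => hxS (by simp [h])
  have hxN : ∀ t ∈ N, x ≠ t := fun t ht h => hxS (by simp [h, ht])
  refine ge_of_tendsto (((hG x).const_sub (f x)).const_mul (x - c)) ?_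
  -- Each factor tends to `(x - t) ^ 2 > 0`, so it is eventually positive although `x` may lie
  -- between `t` and `t + e k` for early `k`.
  have hpos : ∀ᶠ k in Filter.atTop, ∀ t ∈ N, 0 < (x - t) * (x - (t + e (φ k))) := by
    rw [Filter.eventually_all_finset]
    intro t ht
    have hlim : Filter.Tendsto (fun k => (x - t) * (x - (t + e (φ k)))) Filter.atTop
        (nhds ((x - t) * (x - (t + 0)))) :=
      (((hetend.comp hφ.tendsto_atTop).const_add t).const_sub x).const_mul _
    refine hlim.eventually_const_lt ?_
    rw [add_zero]
    exact mul_self_pos.2 (sub_ne_zero.2 (hxN t ht))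
  filter_upwards [hpos] with k hk
  have hxY : x ∉ Y (φ k) := by
    simp only [Y, Finset.mem_union, Finset.mem_image, not_or, not_exists, not_and]
    refine ⟨hxS, fun t ht h => ?_⟩
    have := hk t ht
    rw [← h] at this
    simp at this
  rw [show f x - (H (φ k)).eval x = _ from sub_eval_interpolate_eq f hxY, hprod]
  have hnn : 0 ≤ finsetDividedDiff f (insert x (Y (φ k))) := by
    refine hf.finsetDividedDiff_nonneg ?_ ?_
    · rw [Finset.card_insert_of_notMem hxY, hYc]
    · simp only [Y, Finset.mem_insert, Finset.mem_union, Finset.mem_image]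
      rintro t (rfl | (rfl | ht) | ⟨s, hs, rfl⟩)
      · exact hx
      · exact hc
      · exact Set.Ioo_subset_Icc_self (hN t ht)
      · have h2 := hsep b hbW s (hNW hs) (hN s hs).2.ne'
        rw [abs_of_pos (sub_pos.2 (hN s hs).2)] at h2
        exact ⟨by linarith [(hN s hs).1, he0 (φ k)], by linarith [heη (φ k)]⟩
  have := mul_nonneg (mul_nonneg hnn (mul_self_nonneg (x - c))) (Finset.prod_nonneg fun t ht => (hk t ht).le)
  linarith

/-! ### Weights and orthogonal polynomials -/

theorem intervalIntegrable_eval_mul {a b : ℝ} {w : ℝ → ℝ} (hw : IntervalIntegrable w volume a b)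
    (p : ℝ[X]) : IntervalIntegrable (fun x => p.eval x * w x) volume a b :=
  hw.continuousOn_mul p.continuous.continuousOn

/-- Multiplying a weight by a polynomial that is nonnegative on `[a, b]` gives a weight. -/
theorem IsWeight.eval_mul {a b : ℝ} (hab : a < b) {w : ℝ → ℝ} (hw : IsWeight a b w) {p : ℝ[X]}
    (hp : p ≠ 0) (h0 : ∀ x ∈ Set.Ioo a b, 0 ≤ p.eval x) : IsWeight a b (fun x => p.eval x * w x) := by
  have h0' : ∀ x ∈ Set.Icc a b, 0 ≤ p.eval x := by
    rw [← closure_Ioo hab.ne]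
    exact fun x hx => closure_minimal h0 (isClosed_le continuous_const p.continuous) hx
  have hint := intervalIntegrable_eval_mul hw.integrable p
  refine ⟨fun x hx => mul_nonneg (h0' x hx) (hw.nonneg x hx), hint, ?_⟩
  have hnn : 0 ≤ᵐ[volume.restrict (Set.Ioc a b)] fun x => p.eval x * w x :=
    (ae_restrict_iff' measurableSet_Ioc).2 <| .of_forall fun x hx =>
      mul_nonneg (h0' x ⟨hx.1.le, hx.2⟩) (hw.nonneg x ⟨hx.1.le, hx.2⟩)
  have hnw : 0 ≤ᵐ[volume.restrict (Set.Ioc a b)] w :=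
    (ae_restrict_iff' measurableSet_Ioc).2 <| .of_forall fun x hx => hw.nonneg x ⟨hx.1.le, hx.2⟩
  refine lt_of_le_of_ne (by
    rw [intervalIntegral.integral_of_le hab.le]; exact integral_nonneg_of_ae hnn) fun h => ?_
  have hpos := hw.integral_pos
  rw [intervalIntegral.integral_of_le hab.le] at h hpos
  rw [eq_comm, integral_eq_zero_iff_of_nonneg_ae hnn hint.1] at h
  refine hpos.ne' ?_
  rw [integral_eq_zero_iff_of_nonneg_ae hnw hw.integrable.1]
  -- A nonzero polynomial has finitely many zeros, so if the product vanishes almost everywhere then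
  -- so does `w`.
  have hfin : ∀ᵐ x ∂(volume.restrict (Set.Ioc a b)), x ∉ (p.roots.toFinset : Set ℝ) :=
    ae_restrict_of_ae <| measure_eq_zero_iff_ae_notMem.1 (p.roots.toFinset.finite_toSet.measure_zero _)
  filter_upwards [h, hfin] with x hx hxp
  have : p.eval x ≠ 0 := fun h' => hxp (by simpa [hp] using h')
  simpa [this] using hx

theorem weightedInner_self_pos {a b : ℝ} (hab : a < b) {w : ℝ → ℝ} (hw : IsWeight a b w) {p : ℝ[X]}
    (hp : p ≠ 0) : 0 < weightedInner a b w p p := by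
  have := (hw.eval_mul hab (p := p * p) (mul_ne_zero hp hp) fun x _ => by
    rw [Polynomial.eval_mul]; exact mul_self_nonneg _).integral_pos
  simpa [weightedInner] using this

theorem weightedInner_eq (a b : ℝ) (w : ℝ → ℝ) (p q : ℝ[X]) :
    weightedInner a b w p q = ∫ x in a..b, (p * q).eval x * w x := by
  simp [weightedInner]

theorem weightedInner_sub_left {a b : ℝ} {w : ℝ → ℝ} (hw : IntervalIntegrable w volume a b)
    (p q r : ℝ[X]) :
    weightedInner a b w (p - q) r = weightedInner a b w p r - weightedInner a b w q r := by
  simp only [weightedInner_eq]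
  rw [← intervalIntegral.integral_sub (intervalIntegrable_eval_mul hw _)
    (intervalIntegrable_eval_mul hw _)]
  congr 1; ext x; simp; ring

theorem weightedInner_sum_left {a b : ℝ} {w : ℝ → ℝ} (hw : IntervalIntegrable w volume a b)
    {ι : Type*} (s : Finset ι) (p : ι → ℝ[X]) (r : ℝ[X]) :
    weightedInner a b w (∑ i ∈ s, p i) r = ∑ i ∈ s, weightedInner a b w (p i) r := by
  simp only [weightedInner_eq]
  rw [← intervalIntegral.integral_finsetSum fun i _ => intervalIntegrable_eval_mul hw _]
  congr 1; ext x; simp [Polynomial.eval_finsetSum, Finset.sum_mul]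

theorem weightedInner_C_mul_left (a b : ℝ) (w : ℝ → ℝ) (c : ℝ) (p r : ℝ[X]) :
    weightedInner a b w (C c * p) r = c * weightedInner a b w p r := by
  simp only [weightedInner]
  rw [← intervalIntegral.integral_const_mul]
  congr 1; ext x; simp; ring

theorem weightedInner_comm (a b : ℝ) (w : ℝ → ℝ) (p q : ℝ[X]) :
    weightedInner a b w p q = weightedInner a b w q p := by
  simp only [weightedInner_eq, mul_comm]

theorem orthoPoly_monic_natDegree (a b : ℝ) (w : ℝ → ℝ) (n : ℕ) :
    (orthoPoly a b w n).Monic ∧ (orthoPoly a b w n).natDegree = n := by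
  induction n using Nat.strong_induction_on with
  | _ n ih =>
    have hdeg : (∑ k : Fin n,
        C (weightedInner a b w (X ^ n) (orthoPoly a b w k) /
          weightedInner a b w (orthoPoly a b w k) (orthoPoly a b w k)) *
            orthoPoly a b w k).degree < n := by
      rw [Polynomial.degree_lt_iff_coeff_zero]
      intro j hj
      rw [Polynomial.finsetSum_coeff]
      refine Finset.sum_eq_zero fun k _ => ?_
      rw [Polynomial.coeff_C_mul, Polynomial.coeff_eq_zero_of_natDegree_lt, mul_zero]
      rw [(ih k k.2).2]
      exact k.2.trans_le hj
    rw [orthoPoly]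
    refine ⟨Polynomial.monic_X_pow_sub hdeg, ?_⟩
    rw [sub_eq_add_neg, Polynomial.natDegree_add_eq_left_of_degree_lt] <;> simp [hdeg]

theorem orthoPoly_monic (a b : ℝ) (w : ℝ → ℝ) (n : ℕ) : (orthoPoly a b w n).Monic :=
  (orthoPoly_monic_natDegree a b w n).1

theorem natDegree_orthoPoly (a b : ℝ) (w : ℝ → ℝ) (n : ℕ) : (orthoPoly a b w n).natDegree = n :=
  (orthoPoly_monic_natDegree a b w n).2

theorem weightedInner_orthoPoly_of_lt {a b : ℝ} (hab : a < b) {w : ℝ → ℝ} (hw : IsWeight a b w)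
    (n : ℕ) : ∀ m < n, weightedInner a b w (orthoPoly a b w n) (orthoPoly a b w m) = 0 := by
  induction n using Nat.strong_induction_on with
  | _ n ih =>
    intro m hm
    have hpos := weightedInner_self_pos hab hw (orthoPoly_monic a b w m).ne_zero
    rw [orthoPoly, weightedInner_sub_left hw.integrable, weightedInner_sum_left hw.integrable,
      Finset.sum_eq_single (⟨m, hm⟩ : Fin n)]
    · rw [weightedInner_C_mul_left]
      field_simp
      ring
    · intro k _ hk
      rw [weightedInner_C_mul_left]
      have hk' : (k : ℕ) ≠ m := fun h => hk (Fin.ext h)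
      rcases lt_or_gt_of_ne hk' with h | h
      · rw [weightedInner_comm _ _ _ (orthoPoly a b w k) (orthoPoly a b w m), ih m hm k h, mul_zero]
      · rw [ih k k.2 m h, mul_zero]
    · simp

theorem weightedInner_orthoPoly_of_degree_lt {a b : ℝ} (hab : a < b) {w : ℝ → ℝ}
    (hw : IsWeight a b w) (n : ℕ) (p : ℝ[X]) (hp : p.degree < n) :
    weightedInner a b w p (orthoPoly a b w n) = 0 := by
  suffices H : ∀ m ≤ n, ∀ p : ℝ[X], p.degree < m → weightedInner a b w p (orthoPoly a b w n) = 0 from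
    H n le_rfl p hp
  intro m
  induction m with
  | zero =>
    intro _ p hp
    have : p = 0 := by simpa using hp
    simp [this, weightedInner]
  | succ m ih =>
    intro hm p hp
    -- The orthogonal polynomials are monic of every degree, so subtracting a multiple of one lowers
    -- the degree of `p`.
    have hlt : (p - C (p.coeff m) * orthoPoly a b w m).degree < m := by
      rw [Polynomial.degree_lt_iff_coeff_zero]
      intro k hk
      rcases hk.eq_or_lt with rfl | hk
      · have := (orthoPoly_monic a b w m).coeff_natDegree
        rw [natDegree_orthoPoly] at this
        simp [this]
      · rw [Polynomial.coeff_sub, Polynomial.coeff_C_mul,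
          (Polynomial.degree_lt_iff_coeff_zero p (m + 1)).1 (by exact_mod_cast hp) k hk,
          Polynomial.coeff_eq_zero_of_natDegree_lt (p := orthoPoly a b w m)
            (by rwa [natDegree_orthoPoly])]
        simp
    have h := ih (by omega) _ hlt
    rw [weightedInner_sub_left hw.integrable, weightedInner_C_mul_left, weightedInner_comm _ _ _
      (orthoPoly a b w m), weightedInner_orthoPoly_of_lt hab hw n m (by omega)] at h
    simpa using h

/-! ### Zeros of orthogonal polynomials -/

/-- An orthogonal polynomial has no nonconstant factor of constant sign on the interval. -/
theorem natDegree_eq_zero_of_mul_eq_orthoPoly {a b : ℝ} (hab : a < b) {w : ℝ → ℝ}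
    (hw : IsWeight a b w) {n : ℕ} {u g : ℝ[X]} (hug : orthoPoly a b w n = u * g)
    (hu : ∀ x ∈ Set.Ioo a b, 0 ≤ u.eval x) : u.natDegree = 0 := by
  by_contra hdeg
  have hP := (orthoPoly_monic a b w n).ne_zero
  have hu0 : u ≠ 0 := fun h => hP (by simp [hug, h])
  have hg0 : g ≠ 0 := fun h => hP (by simp [hug, h])
  have hlt : g.degree < n := by
    have h := natDegree_orthoPoly a b w n
    rw [hug, Polynomial.natDegree_mul hu0 hg0] at h
    rw [Polynomial.degree_eq_natDegree hg0]
    exact_mod_cast (by omega : g.natDegree < n)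
  have h1 := weightedInner_orthoPoly_of_degree_lt hab hw n g hlt
  -- Pairing `u * g` with `g` gives the integral of `u g² w`, which is positive, while orthogonality
  -- makes it zero.
  have h2 := (hw.eval_mul hab (p := g * (u * g)) (mul_ne_zero hg0 (mul_ne_zero hu0 hg0)) fun x hx => by
    have := mul_nonneg (hu x hx) (mul_self_nonneg (g.eval x))
    simp only [Polynomial.eval_mul]
    linarith).integral_pos
  rw [weightedInner_eq, hug] at h1
  exact h2.ne' h1

theorem natDegree_eq_zero_of_dvd_orthoPoly {a b : ℝ} (hab : a < b) {w : ℝ → ℝ}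
    (hw : IsWeight a b w) {n : ℕ} {u : ℝ[X]} (hug : u ∣ orthoPoly a b w n)
    (hu : (∀ x ∈ Set.Ioo a b, 0 ≤ u.eval x) ∨ ∀ x ∈ Set.Ioo a b, u.eval x ≤ 0) :
    u.natDegree = 0 := by
  obtain ⟨g, hg⟩ := hug
  rcases hu with hu | hu
  · exact natDegree_eq_zero_of_mul_eq_orthoPoly hab hw hg hu
  · rw [← Polynomial.natDegree_neg]
    exact natDegree_eq_zero_of_mul_eq_orthoPoly hab hw (u := -u) (g := -g) (by rw [hg]; ring)
      fun x hx => by simpa using hu x hx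

theorem orthoPoly_roots_mem {a b : ℝ} (hab : a < b) {w : ℝ → ℝ} (hw : IsWeight a b w) {n : ℕ}
    {t : ℝ} (ht : t ∈ (orthoPoly a b w n).roots) : t ∈ Set.Ioo a b := by
  by_contra hmem
  have hd : X - C t ∣ orthoPoly a b w n := Polynomial.dvd_iff_isRoot.2 (Polynomial.isRoot_of_mem_roots ht)
  have := natDegree_eq_zero_of_dvd_orthoPoly hab hw hd <| by
    rcases le_or_gt t a with h | h
    · left; intro x hx; simp; linarith [hx.1]
    · have h' : b ≤ t := not_lt.1 fun h' => hmem ⟨h, h'⟩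
      right; intro x hx; simp; linarith [hx.2]
  simp at this

theorem orthoPoly_roots_nodup {a b : ℝ} (hab : a < b) {w : ℝ → ℝ} (hw : IsWeight a b w) (n : ℕ) :
    (orthoPoly a b w n).roots.Nodup := by
  rw [Multiset.nodup_iff_count_le_one]
  intro t
  by_contra! hc
  rw [Polynomial.count_roots] at hc
  have hd := (Polynomial.le_rootMultiplicity_iff (orthoPoly_monic a b w n).ne_zero).1
    (Nat.succ_le_of_lt hc)
  have := natDegree_eq_zero_of_dvd_orthoPoly hab hw hd <| .inl fun x _ => by
    simp; positivity
  simp at this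

theorem eval_nonneg_or_nonpos_of_forall_ne_zero {p : ℝ[X]} (h : ∀ x, p.eval x ≠ 0) :
    (∀ x, 0 ≤ p.eval x) ∨ ∀ x, p.eval x ≤ 0 := by
  by_contra! hc
  obtain ⟨⟨x, hx⟩, y, hy⟩ := hc
  obtain ⟨z, hz⟩ := mem_range_of_exists_le_of_exists_ge p.continuous ⟨x, hx.le⟩ ⟨y, hy.le⟩
  exact h z hz

/-- The factor left after splitting off all real roots has constant sign, hence is constant; the
roots, being simple, then number `n`. -/
theorem card_roots_orthoPoly {a b : ℝ} (hab : a < b) {w : ℝ → ℝ} (hw : IsWeight a b w) (n : ℕ) :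
    (orthoPoly a b w n).roots.toFinset.card = n := by
  obtain ⟨q, hq, hcard, hroots⟩ := exists_prod_multiset_X_sub_C_mul (orthoPoly a b w n)
  have hP := (orthoPoly_monic a b w n).ne_zero
  have hq0 : q ≠ 0 := by
    rintro rfl
    exact hP (by rw [← hq, mul_zero])
  have hroot : ∀ x, q.eval x ≠ 0 := fun x hx => by
    have : x ∈ q.roots := (Polynomial.mem_roots hq0).2 hx
    simp [hroots] at this
  have hdeg := natDegree_eq_zero_of_dvd_orthoPoly hab hw (Dvd.intro_left _ hq) <|
    (eval_nonneg_or_nonpos_of_forall_ne_zero hroot).imp (fun h x _ => h x) fun h x _ => h x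
  rw [Multiset.toFinset_card_of_nodup (orthoPoly_roots_nodup hab hw n)]
  rwa [hdeg, natDegree_orthoPoly, add_zero] at hcard

/-! ### Exactness of the Radau quadratures -/

/-- The interpolatory quadrature with nodes `c` and the zeros of an orthogonal polynomial for the
weight `σ (x - c) w(x)` is exact in degrees at most `2 n`. -/
theorem radau_exact {a b : ℝ} (hab : a < b) {w v : ℝ → ℝ} (hw : IsWeight a b w)
    (hv : IsWeight a b v) {c σ : ℝ} (hσ : σ * σ = 1) (hvw : ∀ x, v x = σ * (x - c) * w x)
    (hc : c ∉ Set.Ioo a b) {n : ℕ} {p : ℝ[X]} (hp : p.degree < (2 * n + 1 : ℕ)) :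
    ∫ x in a..b, p.eval x * w x =
      (1 / (orthoPoly a b v n).eval c ^ 2 * ∫ x in a..b, (orthoPoly a b v n).eval x ^ 2 * w x) *
        p.eval c +
      ∑ t ∈ (orthoPoly a b v n).roots.toFinset,
        (1 / (σ * (t - c)) * ∫ x in a..b, (orthoPoly a b v n).eval x * (σ * (x - c)) * w x /
          ((x - t) * (derivative (orthoPoly a b v n)).eval t)) * p.eval t := by
  set P := orthoPoly a b v n with hPdef
  have hP : P.Monic := orthoPoly_monic a b v n
  have hPd : P.natDegree = n := natDegree_orthoPoly a b v n
  have hσ0 : σ ≠ 0 := fun h => by simp [h] at hσ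
  have hroot : ∀ t, t ∈ P.roots.toFinset ↔ P.eval t = 0 := fun t => by
    simp [Polynomial.mem_roots hP.ne_zero, Polynomial.IsRoot]
  have hPc : P.eval c ≠ 0 := fun h =>
    hc (orthoPoly_roots_mem hab hv (Multiset.mem_toFinset.1 ((hroot c).2 h)))
  have htc : ∀ t ∈ P.roots.toFinset, t - c ≠ 0 := fun t ht h =>
    hPc (by rw [← sub_eq_zero.1 h]; exact (hroot t).1 ht)
  have hcard : P.roots.toFinset.card = n := card_roots_orthoPoly hab hv n
  have hnodal : P = Lagrange.nodal P.roots.toFinset id := by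
    have hn := orthoPoly_roots_nodup hab hv n
    have := prod_multiset_X_sub_C_of_monic_of_roots_card_eq hP (by
      rw [← Multiset.toFinset_card_of_nodup hn, hcard, hPd])
    rw [Lagrange.nodal_eq]
    conv_lhs => rw [← this]
    rw [Finset.prod, Multiset.toFinset_val, Multiset.dedup_eq_self.2 hn]
    rfl
  -- remove the node `c`
  obtain ⟨q, hq⟩ : X - C c ∣ p - C (p.eval c / P.eval c ^ 2) * P ^ 2 :=
    Polynomial.dvd_iff_isRoot.2 (by simp [Polynomial.IsRoot]; field_simp; ring)
  have hqeval : ∀ x, p.eval x = p.eval c / P.eval c ^ 2 * P.eval x ^ 2 + (x - c) * q.eval x := by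
    intro x
    have := congrArg (Polynomial.eval x) hq
    simp only [Polynomial.eval_sub, Polynomial.eval_mul, Polynomial.eval_C, Polynomial.eval_pow,
      Polynomial.eval_X] at this
    linarith
  have hqdeg : q ≠ 0 → q.natDegree < 2 * n := by
    intro hq0
    have h1 : ((X - C c) * q).natDegree ≤ 2 * n := by
      rw [← hq]
      refine (Polynomial.natDegree_sub_le _ _).trans (max_le ?_ ?_)
      · exact Polynomial.natDegree_le_iff_coeff_eq_zero.2
          ((Polynomial.degree_lt_iff_coeff_zero p (2 * n + 1)).1 hp)
      · refine (Polynomial.natDegree_C_mul_le _ _).trans (Polynomial.natDegree_pow_le.trans ?_)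
        rw [hPd]
    rw [Polynomial.natDegree_mul (Polynomial.X_sub_C_ne_zero c) hq0,
      Polynomial.natDegree_X_sub_C] at h1
    omega
  -- reduce modulo `P`
  have hs : (q /ₘ P).degree < n := by
    by_cases hs0 : q /ₘ P = 0
    · rw [hs0, Polynomial.degree_zero]; exact WithBot.bot_lt_coe n
    · have hq0 : q ≠ 0 := by rintro rfl; simp at hs0
      have h2 := hqdeg hq0
      rw [Polynomial.degree_eq_natDegree hs0, Polynomial.natDegree_divByMonic q hP, hPd]
      exact_mod_cast (by omega : q.natDegree - n < n)
  have hr : q %ₘ P = ∑ t ∈ P.roots.toFinset, C (q.eval t) * Lagrange.basis P.roots.toFinset id t := by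
    rw [← Lagrange.interpolate_apply]
    refine Lagrange.eq_interpolate_of_eval_eq _ Function.injective_id.injOn ?_ fun t ht => ?_
    · have := Polynomial.degree_modByMonic_lt q hP
      rwa [Polynomial.degree_eq_natDegree hP.ne_zero, hPd, ← hcard] at this
    · have := congrArg (Polynomial.eval t) (Polynomial.modByMonic_add_div q P)
      simpa [(hroot t).1 ht] using this
  have hbasis : ∀ t ∈ P.roots.toFinset, ∀ x, x ≠ t →
      (Lagrange.basis P.roots.toFinset id t).eval x =
        P.eval x / ((x - t) * (derivative P).eval t) := by
    intro t ht x hx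
    rw [Lagrange.eval_basis_not_at_node ht hx, ← hnodal,
      Lagrange.nodalWeight_eq_eval_derivative_nodal ht, ← hnodal]
    simp only [id]
    rw [div_eq_mul_inv, mul_inv]
    ring
  have hint : ∀ t ∈ P.roots.toFinset,
      ∫ x in a..b, P.eval x * (σ * (x - c)) * w x / ((x - t) * (derivative P).eval t) =
        ∫ x in a..b, (Lagrange.basis P.roots.toFinset id t).eval x * v x := by
    intro t ht
    -- The integrands may differ only at `x = t`, where the quotient is a division by zero.
    refine intervalIntegral.integral_congr_ae ?_
    filter_upwards [measure_eq_zero_iff_ae_notMem.1 (measure_singleton (μ := volume) t)]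
      with x hx _
    rw [hbasis t ht x hx, hvw]
    ring
  have hqv : ∫ x in a..b, q.eval x * v x = ∑ t ∈ P.roots.toFinset, q.eval t *
      ∫ x in a..b, (Lagrange.basis P.roots.toFinset id t).eval x * v x := by
    have h0 : ∫ x in a..b, ((q /ₘ P) * P).eval x * v x = 0 := by
      rw [← weightedInner_eq]
      exact weightedInner_orthoPoly_of_degree_lt hab hv n _ hs
    have h1 : ∀ x, q.eval x * v x = ((q /ₘ P) * P).eval x * v x + ∑ t ∈ P.roots.toFinset,
        q.eval t * ((Lagrange.basis P.roots.toFinset id t).eval x * v x) := by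
      intro x
      have := congrArg (Polynomial.eval x) (Polynomial.modByMonic_add_div q P)
      rw [hr] at this
      rw [← this]
      simp only [Polynomial.eval_add, Polynomial.eval_mul, Polynomial.eval_finsetSum,
        Polynomial.eval_C, add_mul, Finset.sum_mul]
      rw [add_comm, mul_comm (Polynomial.eval x P)]
      simp only [mul_assoc]
    simp only [h1]
    rw [intervalIntegral.integral_add (intervalIntegrable_eval_mul hv.integrable _), h0, zero_add,
      intervalIntegral.integral_finsetSum]
    · simp only [intervalIntegral.integral_const_mul]
    · exact fun t _ => (intervalIntegrable_eval_mul hv.integrable _).const_mul _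
    · have := IntervalIntegrable.sum (μ := volume) (a := a) (b := b) P.roots.toFinset
        (f := fun t x => q.eval t * ((Lagrange.basis P.roots.toFinset id t).eval x * v x))
        fun t _ => (intervalIntegrable_eval_mul hv.integrable _).const_mul _
      simpa only [Finset.sum_fn] using this
  have hsplit : ∫ x in a..b, p.eval x * w x =
      p.eval c / P.eval c ^ 2 * (∫ x in a..b, P.eval x ^ 2 * w x) +
        σ * ∫ x in a..b, q.eval x * v x := by
    rw [← intervalIntegral.integral_const_mul, ← intervalIntegral.integral_const_mul,
      ← intervalIntegral.integral_add]
    · congr 1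
      ext x
      rw [hqeval x, hvw]
      -- As `σ * σ = 1`, one has `(x - c) * w x = σ * v x`; the sign `σ` lets one proof serve both
      -- endpoints.
      linear_combination (-(x - c) * q.eval x * w x) * hσ
    · simp only [← Polynomial.eval_pow]
      exact (intervalIntegrable_eval_mul hw.integrable (P ^ 2)).const_mul _
    · exact (intervalIntegrable_eval_mul hv.integrable _).const_mul _
  rw [hsplit, hqv, Finset.mul_sum]
  congr 1
  · ring
  · refine Finset.sum_congr rfl fun t ht => ?_
    have hp' : p.eval t = (t - c) * q.eval t := by simp [hqeval t, (hroot t).1 ht]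
    rw [hint t ht, hp']
    have := htc t ht
    field_simp
    linear_combination
      (∫ x in a..b, (Lagrange.basis P.roots.toFinset id t).eval x * v x) * q.eval t * hσ

/-! ### One-sided interpolants, integrability and conclusion -/

theorem IsWeight.left {a b : ℝ} (hab : a < b) {w : ℝ → ℝ} (hw : IsWeight a b w) :
    IsWeight a b (fun x => (x - a) * w x) := by
  simpa using hw.eval_mul hab (p := X - C a) (Polynomial.X_sub_C_ne_zero a) fun x hx => by
    simpa using hx.1.le

theorem IsWeight.right {a b : ℝ} (hab : a < b) {w : ℝ → ℝ} (hw : IsWeight a b w) :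
    IsWeight a b (fun x => (b - x) * w x) := by
  have hne : C b - X ≠ 0 := by
    rw [← neg_ne_zero, neg_sub]
    exact Polynomial.X_sub_C_ne_zero b
  have h := hw.eval_mul hab hne fun x hx => by simpa using hx.2.le
  simpa only [Polynomial.eval_sub, Polynomial.eval_C, Polynomial.eval_X] using h

/-- A higher-convex function of even order lies above a polynomial interpolating it at `a` and
prescribed interior nodes. -/
theorem IsHigherConvexOn.exists_interpolant_le {a b : ℝ} (hab : a < b) {n : ℕ} {f : ℝ → ℝ}
    (hf : IsHigherConvexOn (2 * n) (Set.Icc a b) f) {N : Finset ℝ}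
    (hN : ∀ t ∈ N, t ∈ Set.Ioo a b) (hNc : N.card = n) :
    ∃ H : ℝ[X], H.degree < (2 * n + 1 : ℕ) ∧ H.eval a = f a ∧ (∀ t ∈ N, H.eval t = f t) ∧
      ∀ x ∈ Set.Icc a b, H.eval x ≤ f x := by
  obtain ⟨H, h1, h2, h3, h4⟩ := hf.exists_interpolant hab (Set.left_mem_Icc.2 hab.le) hN
    (fun h => lt_irrefl _ (hN _ h).1) hNc
  refine ⟨H, h1, h2, h3, fun x hx => ?_⟩
  rcases hx.1.eq_or_lt with rfl | hlt
  · exact h2.le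
  · exact sub_nonneg.1 (nonneg_of_mul_nonneg_right (h4 x hx) (sub_pos.2 hlt))

/-- A higher-convex function of even order lies below a polynomial interpolating it at `b` and
prescribed interior nodes. -/
theorem IsHigherConvexOn.exists_le_interpolant {a b : ℝ} (hab : a < b) {n : ℕ} {f : ℝ → ℝ}
    (hf : IsHigherConvexOn (2 * n) (Set.Icc a b) f) {N : Finset ℝ}
    (hN : ∀ t ∈ N, t ∈ Set.Ioo a b) (hNc : N.card = n) :
    ∃ H : ℝ[X], H.degree < (2 * n + 1 : ℕ) ∧ H.eval b = f b ∧ (∀ t ∈ N, H.eval t = f t) ∧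
      ∀ x ∈ Set.Icc a b, f x ≤ H.eval x := by
  obtain ⟨H, h1, h2, h3, h4⟩ := hf.exists_interpolant hab (Set.right_mem_Icc.2 hab.le) hN
    (fun h => lt_irrefl _ (hN _ h).2) hNc
  refine ⟨H, h1, h2, h3, fun x hx => ?_⟩
  rcases hx.2.eq_or_lt with rfl | hlt
  · exact h2.ge
  · nlinarith [h4 x hx]

/-- Taking `z` as a node squeezes `f` between two polynomials that agree with it at `z`; `1 ≤ n`
provides an interior node. -/
theorem IsHigherConvexOn.continuousOn_Ioo {a b : ℝ} (hab : a < b) {n : ℕ} (hn : 1 ≤ n)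
    {f : ℝ → ℝ} (hf : IsHigherConvexOn (2 * n) (Set.Icc a b) f) :
    ContinuousOn f (Set.Ioo a b) := by
  intro z hz
  obtain ⟨N, hzN, hNI, hNc⟩ : ∃ N : Finset ℝ, z ∈ N ∧ (∀ t ∈ N, t ∈ Set.Ioo a b) ∧ N.card = n := by
    obtain ⟨N, hN, hNc⟩ := ((Set.Ioo_infinite hab).sdiff
      (Set.finite_singleton z)).exists_subset_card_eq (n - 1)
    refine ⟨insert z N, by simp, ?_, ?_⟩
    · simp only [Finset.mem_insert]
      rintro t (rfl | ht)
      exacts [hz, (hN ht).1]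
    · rw [Finset.card_insert_of_notMem fun h => (hN h).2 rfl, hNc]
      omega
  obtain ⟨L, -, -, hL, hLf⟩ := hf.exists_interpolant_le hab hNI hNc
  obtain ⟨U, -, -, hU, hUf⟩ := hf.exists_le_interpolant hab hNI hNc
  have h1 := L.continuous.continuousWithinAt (s := Set.Ioo a b) (x := z)
  have h2 := U.continuous.continuousWithinAt (s := Set.Ioo a b) (x := z)
  simp only [ContinuousWithinAt] at h1 h2 ⊢
  rw [hL z hzN] at h1
  rw [hU z hzN] at h2
  refine tendsto_of_tendsto_of_tendsto_of_le_of_le' h1 h2 ?_ ?_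
  · filter_upwards [self_mem_nhdsWithin] with x hx using hLf x (Set.Ioo_subset_Icc_self hx)
  · filter_upwards [self_mem_nhdsWithin] with x hx using hUf x (Set.Ioo_subset_Icc_self hx)

/-- Continuity serves only for measurability; the bound comes from the polynomials, and the
endpoints are negligible. -/
theorem intervalIntegrable_mul_of_continuousOn_Ioo {a b : ℝ} (hab : a < b) {f w : ℝ → ℝ}
    (hw : IntervalIntegrable w volume a b) (hf : ContinuousOn f (Set.Ioo a b)) {L U : ℝ[X]}
    (hL : ∀ x ∈ Set.Icc a b, L.eval x ≤ f x) (hU : ∀ x ∈ Set.Icc a b, f x ≤ U.eval x) :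
    IntervalIntegrable (fun x => f x * w x) volume a b := by
  obtain ⟨B, hB⟩ := isCompact_Icc.exists_bound_of_continuousOn (s := Set.Icc a b)
    L.continuous.continuousOn
  obtain ⟨D, hD⟩ := isCompact_Icc.exists_bound_of_continuousOn (s := Set.Icc a b)
    U.continuous.continuousOn
  rw [intervalIntegrable_iff_integrableOn_Ioo_of_le hab.le] at hw ⊢
  refine Integrable.bdd_mul (c := max B D) hw (hf.aestronglyMeasurable measurableSet_Ioo) ?_
  refine (ae_restrict_iff' measurableSet_Ioo).2 (.of_forall fun x hx => ?_)
  have hx' := Set.Ioo_subset_Icc_self hx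
  have h1 := hB x hx'
  have h2 := hD x hx'
  rw [Real.norm_eq_abs, abs_le] at *
  constructor
  · linarith [hL x hx', le_max_left B D]
  · linarith [hU x hx', le_max_right B D]

theorem mainTheorem4 (a b : ℝ) (hab : a < b) (w : ℝ → ℝ) (hw : IsWeight a b w)
    (n : ℕ) (hn : 1 ≤ n) :
    ((radauLeftPoly a b w n).roots.toFinset.card = n ∧
      ∀ t ∈ (radauLeftPoly a b w n).roots, t ∈ Set.Ioo a b) ∧
    ((radauRightPoly a b w n).roots.toFinset.card = n ∧
      ∀ t ∈ (radauRightPoly a b w n).roots, t ∈ Set.Ioo a b) ∧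
    ∀ f : ℝ → ℝ, IsHigherConvexOn (2 * n) (Set.Icc a b) f →
      IntervalIntegrable (fun x => f x * w x) volume a b ∧
      radauLeft a b w n f ≤ ∫ x in a..b, f x * w x ∧
      ∫ x in a..b, f x * w x ≤ radauRight a b w n f := by
  have hl := hw.left hab
  have hr := hw.right hab
  have hlc : (radauLeftPoly a b w n).roots.toFinset.card = n := card_roots_orthoPoly hab hl n
  have hrc : (radauRightPoly a b w n).roots.toFinset.card = n := card_roots_orthoPoly hab hr n
  have hlm : ∀ t ∈ (radauLeftPoly a b w n).roots, t ∈ Set.Ioo a b :=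
    fun t ht => orthoPoly_roots_mem hab hl ht
  have hrm : ∀ t ∈ (radauRightPoly a b w n).roots, t ∈ Set.Ioo a b :=
    fun t ht => orthoPoly_roots_mem hab hr ht
  refine ⟨⟨hlc, hlm⟩, ⟨hrc, hrm⟩, fun f hf => ?_⟩
  obtain ⟨L, hLd, hLa, hLn, hLf⟩ := hf.exists_interpolant_le hab
    (fun t ht => hlm t (Multiset.mem_toFinset.1 ht)) hlc
  obtain ⟨U, hUd, hUb, hUn, hUf⟩ := hf.exists_le_interpolant hab
    (fun t ht => hrm t (Multiset.mem_toFinset.1 ht)) hrc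
  have hint := intervalIntegrable_mul_of_continuousOn_Ioo hab hw.integrable
    (hf.continuousOn_Ioo hab hn) hLf hUf
  refine ⟨hint, ?_, ?_⟩
  · have hex := radau_exact hab hw hl (c := a) (σ := 1) (one_mul 1) (fun x => by ring)
      (fun h => lt_irrefl _ h.1) hLd
    -- The quadrature sees `f` only at its nodes, where `f` and `L` agree.
    have heq : radauLeft a b w n f = ∫ x in a..b, L.eval x * w x := by
      rw [hex, radauLeft, hLa]
      congr 1
      refine Finset.sum_congr rfl fun t ht => ?_
      rw [← hLn t ht]
      simp only [one_mul, radauLeftPoly]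
    rw [heq]
    exact intervalIntegral.integral_mono_on hab.le (intervalIntegrable_eval_mul hw.integrable L)
      hint fun x hx => mul_le_mul_of_nonneg_right (hLf x hx) (hw.nonneg x hx)
  · have hex := radau_exact hab hw hr (c := b) (σ := -1) (by norm_num) (fun x => by ring)
      (fun h => lt_irrefl _ h.2) hUd
    have heq : radauRight a b w n f = ∫ x in a..b, U.eval x * w x := by
      rw [hex, radauRight, hUb, add_comm]
      congr 1
      refine Finset.sum_congr rfl fun t ht => ?_
      rw [← hUn t ht]
      simp only [neg_mul, one_mul, neg_sub, radauRightPoly]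
    rw [heq]
    exact intervalIntegral.integral_mono_on hab.le hint
      (intervalIntegrable_eval_mul hw.integrable U)
      fun x hx => mul_le_mul_of_nonneg_right (hUf x hx) (hw.nonneg x hx)
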